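/- \textbf{Setting.} Let $R$ be an integral domain with field of fractions $\mathbb F$. A cellular $R$-algebra $A$ has an involution $*$, a finite poset $(\widehat A,\unrhd)$, finite nonempty index sets $I(\lambda)$ ($\lambda\in\widehat A$) and a cellular basis $\{c^\lambda_{\mathsf s\mathsf t}\mid \lambda\in\widehat A,\ \mathsf s,\mathsf t\in I(\lambda)\}$ in the sense of Graham--Lehrer (with right multiplication): $c^\lambda_{\mathsf s\mathsf t}a\equiv\sum_{\mathsf v} r(a;\mathsf t,\mathsf v)c^\lambda_{\mathsf s\mathsf v}$ modulo $A^{\rhd\lambda}$, with coefficients independent of $\mathsf s$, and $(c^\lambda_{\mathsf s\mathsf t})^*\equiv c^\lambda_{\mathsf t\mathsf s}$ modulo $A^{\rhd\lambda}$. Here $A^{\rhd\lambda}$ (resp. $A^{\unrhd\lambda}$) is the $R$-span of the $c^\mu_{\mathsf s\mathsf t}$ with $\mu\rhd\lambda$ (resp. $\mu\unrhd\lambda$). The cell module $\Delta(\lambda)$ is the right $A$-module that is free over $R$ on $\{c_{\mathsf t}\mid \mathsf t\in I(\lambda)\}$ with $c_{\mathsf t}a=\sum_{\mathsf v}r(a;\mathsf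 t,\mathsf v)c_{\mathsf v}$. An order preserving cell filtration of a right $A$-module $M$ is a filtration $0=M_0\subseteq M_1\subseteq\dots\subseteq M_k=M$ by submodules with $M_i/M_{i-1}\cong\Delta(\lambda^{(i)})$ and $\lambda^{(1)}\rhd\lambda^{(2)}\rhd\cdots$. Let $A_0\subseteq A_1\subseteq A_2\subseteq\cdots$ be an increasing sequence of cellular $R$-algebras with unital inclusions and consistent involutions; write $\widehat A_r$ and $\Delta_r(\lambda)$ for the posets and cell modules. Assume that it is a \emph{sequence of diagram algebras}, that is: \begin{itemize} \item $A_0=R$ (so $\widehat A_0=\{\varnothing\}$); \item each cell module $\Delta_r(\lambda)$ is cyclic; fix a generator $\delta_r(\lambda)$, an isomorphism of bimodules $\alpha_\lambda:A_r^{\unrhd\lambda}/A_r^{\rhd\lambda}\to\Delta_r(\lambda)^*\otimes_R\Delta_r(\lambda)$ and an element $m_\lambda\in A_r^{\unrhd\lambda}$ with $\alpha_\lambda(m_\lambda+A_r^{\rhd\lambda})=\delta_r(\lambda)^*\otimes\delta_r(\lambda)$, where $m_\varnothing=1$; \item $m_\lambda^*=m_\lambda$; \item $A_r\otimes_R\mathbb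 F$ is split semisimple for all $r$; \item for all $r$ and $\mu\in\widehat A_{r+1}$, the restriction of $\Delta_{r+1}(\mu)$ to $A_r$ has an order preserving cell filtration; fix one, with isomorphisms $M_i/M_{i-1}\cong\Delta_r(\lambda^{(i)})$. For $\lambda\in\widehat A_r$ write $\lambda\to\mu$ if $\Delta_r(\lambda)$ occurs as a subquotient of an order preserving cell filtration of this restriction. Fix branching factors $d_{\lambda\to\mu}\in A_{r+1}$ such that, for $\lambda=\lambda^{(i)}$, the element $\delta_{r+1}(\mu)d_{\lambda\to\mu}$ lies in $M_i$ and its class in $M_i/M_{i-1}\cong\Delta_r(\lambda)$ is $\delta_r(\lambda)$; \item there are elements $u_{\lambda\to\mu}\in A_{r+1}$ with $m_\mu d_{\lambda\to\mu}=(u_{\lambda\to\mu})^*m_\lambda$ for every edge $\lambda\to\mu$; fix them. \end{itemize} For $s\le r$, a path $\mathsf t=(\mathsf t(s)\to\mathsf t(s+1)\to\dots\to\mathsf t(r))$ has vertices $\mathsf t(j)\in\widehat A_j$, and $u_{\mathsf t}=u_{\mathsf t(s)\to\mathsf t(s+1)}\cdots u_{\mathsf t(r-1)\to\mathsf t(r)}$.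 For $s\le p\le q\le r$, $\mathsf t_{[p,q]}$ is its truncation to levels $p,\dots,q$. For two paths $\mathsf s,\mathsf t$ from level $s$ to level $r$, $\mathsf s\rhd\mathsf t$ means that $\mathsf s\neq\mathsf t$ and $\mathsf s(j)\unrhd\mathsf t(j)$ for all $s\le j\le r$. Let $\mathrm{Std}_r(\nu)$ be the set of paths from $\varnothing\in\widehat A_0$ to $\nu\in\widehat A_r$. \textbf{Statement.} Let $1\le s<r$, $\nu\in\widehat A_r$, $\mathsf t\in\mathrm{Std}_r(\nu)$ and $\lambda=\mathsf t(s)$. Let $a\in A_s$ and let $r_{\mathsf s}\in R$ ($\mathsf s\in\mathrm{Std}_s(\lambda)$) be such that $$u^*_{\mathsf t_{[0,s]}}\,a\equiv\sum_{\mathsf s\in\mathrm{Std}_s(\lambda)}r_{\mathsf s}u^*_{\mathsf s}\mod A_s^{\rhd\lambda}.$$ Then there exist coefficients $r'_{\mathsf z}\in R$ such that $$u^*_{\mathsf t}\,a\equiv\sum_{\mathsf s\in\mathrm{Std}_s(\lambda)}r_{\mathsf s}\,u^*_{\mathsf t_{[s,r]}}u^*_{\mathsf s}+\sum_{\substack{\mathsf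 z\in\mathrm{Std}_r(\nu)\\ \mathsf z_{[s,r]}\rhd\mathsf t_{[s,r]},\ \mathsf z(s)\rhd\lambda}}r'_{\mathsf z}u^*_{\mathsf z}\mod A_r^{\rhd\nu}.$$ -/

import Mathlib

open scoped TensorProduct

universe u v w w'

set_option linter.checkUnivs false

/-- An algebra involution: an `R`-linear anti-automorphism of order two. -/
structure AlgInvolution (R : Type u) (A : Type v) [CommRing R] [Ring A] [Algebra R A] where
  toLin : A →ₗ[R] A
  map_mul : ∀ x y : A, toLin (x * y) = toLin y * toLin x
  invol : ∀ x : A, toLin (toLin x) = x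

/-- A cell datum for the `R`-algebra `A`.  The partial order `⊵` is `≥`, so `μ ▷ lam` is
`lam < μ`.  The finite index sets (called `Idx` here, to distinguish them from the sets of
paths below) are nonempty, i.e. no cell module is zero. -/
structure CellDatum (R : Type u) (A : Type v) [CommRing R] [Ring A] [Algebra R A] where
  inv : AlgInvolution R A
  Shape : Type w
  [shapeOrder : PartialOrder Shape]
  [shapeFintype : Fintype Shape]
  Idx : Shape → Type w'
  [idxFintype : ∀ lam, Fintype (Idx lam)]
  [idxNonempty : ∀ lam, Nonempty (Idx lam)]
  /-- the cellular basis `c^lam_{s t}`, indexed by the triples `⟨lam, s, t⟩` -/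
  basis : Module.Basis (Σ lam : Shape, Idx lam × Idx lam) R A
  mul_basis : ∀ (lam : Shape) (t : Idx lam) (a : A), ∃ c : Idx lam → R, ∀ s : Idx lam,
    basis ⟨lam, s, t⟩ * a - ∑ v, c v • basis ⟨lam, s, v⟩ ∈
      Submodule.span R {x | ∃ (μ : Shape) (p q : Idx μ), lam < μ ∧ x = basis ⟨μ, p, q⟩}
  inv_basis : ∀ (lam : Shape) (s t : Idx lam),
    inv.toLin (basis ⟨lam, s, t⟩) - basis ⟨lam, t, s⟩ ∈
      Submodule.span R {x | ∃ (μ : Shape) (p q : Idx μ), lam < μ ∧ x = basis ⟨μ, p, q⟩}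

namespace CellDatum

attribute [instance] CellDatum.shapeOrder CellDatum.shapeFintype CellDatum.idxFintype
  CellDatum.idxNonempty

variable {R : Type u} {A : Type v} [CommRing R] [Ring A] [Algebra R A]
  (D : CellDatum.{u, v, w, w'} R A)

/-- `A^{▷ lam}`. -/
def above (lam : D.Shape) : Submodule R A :=
  Submodule.span R {x | ∃ (μ : D.Shape) (p q : D.Idx μ), lam < μ ∧ x = D.basis ⟨μ, p, q⟩}

/-- `A^{⊵ lam}`. -/
def atLeast (lam : D.Shape) : Submodule R A :=
  Submodule.span R {x | ∃ (μ : D.Shape) (p q : D.Idx μ), lam ≤ μ ∧ x = D.basis ⟨μ, p, q⟩}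

theorem above_le_atLeast {lam μ : D.Shape} (h : lam ≤ μ) : D.above μ ≤ D.atLeast lam := by
  refine Submodule.span_mono ?_
  rintro x ⟨κ, p, q, hκ, rfl⟩
  exact ⟨κ, p, q, h.trans hκ.le, rfl⟩

theorem mul_right_mem {lam : D.Shape} {x : A} (hx : x ∈ D.atLeast lam) (a : A) :
    x * a ∈ D.atLeast lam := by
  refine Submodule.span_induction (p := fun x _ => x * a ∈ D.atLeast lam) ?_ ?_ ?_ ?_ hx
  · rintro x ⟨μ, p, q, hμ, rfl⟩
    obtain ⟨c, hc⟩ := D.mul_basis μ q a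
    have h1 := D.above_le_atLeast hμ (hc p)
    have h2 : ∑ v, c v • D.basis ⟨μ, p, v⟩ ∈ D.atLeast lam :=
      Submodule.sum_mem _ fun v _ => Submodule.smul_mem _ _
        (Submodule.subset_span ⟨μ, p, v, hμ, rfl⟩)
    simpa using Submodule.add_mem _ h1 h2
  · simp
  · intro x y _ _ hx hy
    rw [add_mul]
    exact Submodule.add_mem _ hx hy
  · intro c x _ hx
    rw [smul_mul_assoc]
    exact Submodule.smul_mem _ _ hx

theorem inv_mem {lam : D.Shape} {x : A} (hx : x ∈ D.atLeast lam) :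
    D.inv.toLin x ∈ D.atLeast lam := by
  refine Submodule.span_induction (p := fun x _ => D.inv.toLin x ∈ D.atLeast lam) ?_ ?_ ?_ ?_ hx
  · rintro x ⟨μ, p, q, hμ, rfl⟩
    have h1 := D.above_le_atLeast hμ (D.inv_basis μ p q)
    have h2 : D.basis ⟨μ, q, p⟩ ∈ D.atLeast lam := Submodule.subset_span ⟨μ, q, p, hμ, rfl⟩
    simpa using Submodule.add_mem _ h1 h2
  · simp
  · intro x y _ _ hx hy
    rw [map_add]
    exact Submodule.add_mem _ hx hy
  · intro c x _ hx
    rw [map_smul]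
    exact Submodule.smul_mem _ _ hx

theorem mul_left_mem {lam : D.Shape} {x : A} (hx : x ∈ D.atLeast lam) (b : A) :
    b * x ∈ D.atLeast lam := by
  have h := D.inv_mem (D.mul_right_mem (D.inv_mem hx) (D.inv.toLin b))
  rwa [D.inv.map_mul, D.inv.invol, D.inv.invol] at h

/-- The `R`-module underlying the cell module `Δ(lam)`: free on `Idx lam`. -/
abbrev CellModule (lam : D.Shape) : Type (max w' u) := D.Idx lam → R

/-- The coefficient `r(a; t, v)` of `c_{s v}` in `c_{s t} a` modulo `A^{▷ lam}`.  It does not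
depend on `s`, and is read off at `s = t`. -/
noncomputable def coeff (lam : D.Shape) (a : A) : Matrix (D.Idx lam) (D.Idx lam) R :=
  fun t v => D.basis.repr (D.basis ⟨lam, t, t⟩ * a) ⟨lam, t, v⟩

/-- The right action of `a` on the cell module: `c_t a = ∑ v, r(a; t, v) c_v`. -/
noncomputable def act (lam : D.Shape) (a : A) : D.CellModule lam →ₗ[R] D.CellModule lam :=
  (D.coeff lam a).vecMulLinear

/-- An isomorphism of `A`-`A`-bimodules `A^{⊵ lam} / A^{▷ lam} → Δ(lam)^* ⊗ Δ(lam)`.  On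
`Δ(lam)^*`, the module `Δ(lam)` turned into a left module, `b` acts as `b^*` does on
`Δ(lam)`. -/
structure CellBimoduleIso (lam : D.Shape) where
  equiv : (↥(D.atLeast lam) ⧸ (D.above lam).submoduleOf (D.atLeast lam)) ≃ₗ[R]
    D.CellModule lam ⊗[R] D.CellModule lam
  map_mul : ∀ (b a : A) (x : D.atLeast lam),
    equiv (Submodule.Quotient.mk ⟨b * x * a, D.mul_right_mem (D.mul_left_mem x.2 b) a⟩) =
      TensorProduct.map (D.act lam (D.inv.toLin b)) (D.act lam a)
        (equiv (Submodule.Quotient.mk x))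

/-- An order preserving cell filtration `0 = M_0 ⊆ M_1 ⊆ ⋯ ⊆ M_len = M` of a right `A`-module
`M`, whose action is given by `ρ`: `M_{i+1} / M_i ≅ Δ(label i)` as right `A`-modules, with
`label 0 ▷ label 1 ▷ ⋯`. -/
structure OrderedCellFiltration {M : Type*} [AddCommGroup M] [Module R M]
    (ρ : A → M →ₗ[R] M) where
  len : ℕ
  N : Fin (len + 1) → Submodule R M
  N_zero : N 0 = ⊥
  N_last : N (Fin.last len) = ⊤
  N_mono : Monotone N
  N_stable : ∀ i, ∀ a : A, ∀ x ∈ N i, ρ a x ∈ N i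
  label : Fin len → D.Shape
  label_anti : StrictAnti label
  iso : ∀ i : Fin len, (↥(N i.succ) ⧸ (N i.castSucc).submoduleOf (N i.succ)) ≃ₗ[R]
    D.CellModule (label i)
  iso_act : ∀ (i : Fin len) (a : A) (x : N i.succ),
    iso i (Submodule.Quotient.mk ⟨ρ a x, N_stable i.succ a x x.2⟩) =
      D.act (label i) a (iso i (Submodule.Quotient.mk x))

end CellDatum

/-- A finite product of full matrix algebras over the field `F`. -/
def IsSplitSemisimple (F : Type*) (S : Type*) [Field F] [Ring S] [Algebra F S] : Prop :=
  ∃ (n : ℕ) (d : Fin n → ℕ), (∀ i, d i ≠ 0) ∧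
    Nonempty (S ≃ₐ[F] ((i : Fin n) → Matrix (Fin (d i)) (Fin (d i)) F))

/-- An increasing sequence of cellular algebras with consistent involutions, realized as
subalgebras of an algebra `B` with involution (for instance of their union). -/
structure CellularTower (R : Type u) (B : Type v) [CommRing R] [Ring B] [Algebra R B] where
  alg : ℕ → Subalgebra R B
  alg_mono : Monotone alg
  inv : AlgInvolution R B
  datum : ∀ r, CellDatum.{u, v, w, w'} R (alg r)
  inv_compat : ∀ r (x : alg r), ((datum r).inv.toLin x : B) = inv.toLin (x : B)

namespace CellularTower

variable {R : Type u} {B : Type v} [CommRing R] [Ring B] [Algebra R B]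
  (T : CellularTower.{u, v, w, w'} R B)

/-- The poset `Â_r`. -/
abbrev Shape (r : ℕ) : Type w := (T.datum r).Shape

/-- The cell module `Δ_r(lam)`. -/
abbrev Cell (r : ℕ) (lam : T.Shape r) : Type (max w' u) := (T.datum r).CellModule lam

/-- The action of `A_r` on the restriction of `Δ_{r+1}(μ)` to `A_r`. -/
noncomputable def resAct (r : ℕ) (μ : T.Shape (r + 1)) (a : T.alg r) :
    T.Cell (r + 1) μ →ₗ[R] T.Cell (r + 1) μ :=
  (T.datum (r + 1)).act μ (Subalgebra.inclusion (T.alg_mono r.le_succ) a)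

/-- Order preserving cell filtrations of the restriction of `Δ_{r+1}(μ)` to `A_r`. -/
abbrev ResFiltration (r : ℕ) (μ : T.Shape (r + 1)) :=
  (T.datum r).OrderedCellFiltration (T.resAct r μ)

/-- The edges `lam → μ` of the branching diagram: `Δ_r(lam)` is a subquotient of an order
preserving cell filtration of the restriction of `Δ_{r+1}(μ)`. -/
def Edge (r : ℕ) (lam : T.Shape r) (μ : T.Shape (r + 1)) : Prop :=
  ∃ (𝓕 : T.ResFiltration r μ) (i : Fin 𝓕.len), 𝓕.label i = lam

/-- `A_r^{▷ ν}`, as a submodule of the ambient algebra. -/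
noncomputable def above (r : ℕ) (ν : T.Shape r) : Submodule R B :=
  ((T.datum r).above ν).map (T.alg r).val.toLinearMap

/-- Paths on the branching diagram from level `s` to level `r`, that is `Std_{s,r}`. -/
@[ext] structure SkewPath (s r : ℕ) where
  vertex : (j : Set.Icc s r) → T.Shape j
  edge : ∀ (j : ℕ) (h : s ≤ j) (h' : j + 1 ≤ r),
    T.Edge j (vertex ⟨j, h, j.le_succ.trans h'⟩) (vertex ⟨j + 1, h.trans j.le_succ, h'⟩)

instance (s r : ℕ) : Finite (T.SkewPath s r) :=
  Finite.of_injective SkewPath.vertex fun _ _ h => SkewPath.ext h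

namespace SkewPath

variable {T}

/-- The truncation `t_{[p, q]}`. -/
def trunc {s r : ℕ} (t : T.SkewPath s r) (p q : ℕ) (hp : s ≤ p) (hq : q ≤ r) :
    T.SkewPath p q where
  vertex j := t.vertex ⟨j, hp.trans j.2.1, j.2.2.trans hq⟩
  edge j h h' := t.edge j (hp.trans h) (h'.trans hq)

/-- Dominance order `p ⊵ q`. -/
def Dominates {s r : ℕ} (p q : T.SkewPath s r) : Prop :=
  ∀ j, q.vertex j ≤ p.vertex j

/-- Strict dominance order `p ▷ q`. -/
def StrictlyDominates {s r : ℕ} (p q : T.SkewPath s r) : Prop :=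
  p ≠ q ∧ p.Dominates q

end SkewPath

/-- `Std_r(ν)`: the paths from level `0` to the vertex `ν` at level `r`.  (In a sequence of
diagram algebras `Â_0` is a singleton, so that all of them start at its unique element.) -/
def Std (r : ℕ) (ν : T.Shape r) : Type w :=
  {t : T.SkewPath 0 r // t.vertex ⟨r, Nat.zero_le r, le_rfl⟩ = ν}

noncomputable instance (r : ℕ) (ν : T.Shape r) : Fintype (T.Std r ν) :=
  letI : Finite (T.Std r ν) := Subtype.finite
  Fintype.ofFinite _

end CellularTower

/-- A sequence of diagram algebras over the integral domain `R`, together with the choices that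
are fixed for it: the isomorphisms `α`, the generators `δ` of the cell modules, their lifts `m`,
the filtrations of the restricted cell modules, and the branching factors `d` and `u`. -/
structure DiagramAlgebras (R : Type u) (B : Type v) [CommRing R] [IsDomain R] [Ring B]
    [Algebra R B] extends CellularTower.{u, v, w, w'} R B where
  /-- `A_0 = R` -/
  alg_zero : Function.Bijective (algebraMap R (alg 0))
  δ : ∀ r (lam : toCellularTower.Shape r), toCellularTower.Cell r lam
  /-- the cell modules are cyclic, generated by the `δ r lam` -/
  cyclic : ∀ r lam (x : toCellularTower.Cell r lam), ∃ a, (datum r).act lam a (δ r lam) = x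
  α : ∀ r lam, (datum r).CellBimoduleIso lam
  m : ∀ r, toCellularTower.Shape r → alg r
  m_mem : ∀ r lam, m r lam ∈ (datum r).atLeast lam
  α_m : ∀ r lam,
    (α r lam).equiv (Submodule.Quotient.mk ⟨m r lam, m_mem r lam⟩) = δ r lam ⊗ₜ[R] δ r lam
  m_zero : ∀ lam, m 0 lam = 1
  inv_m : ∀ r lam, (datum r).inv.toLin (m r lam) = m r lam
  splitSemisimple : ∀ r, IsSplitSemisimple (FractionRing R) (FractionRing R ⊗[R] alg r)
  /-- restriction coherence: order preserving cell filtrations, one being fixed for each `μ` -/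
  filt : ∀ r (μ : toCellularTower.Shape (r + 1)), toCellularTower.ResFiltration r μ
  /-- the branching factors `d_{lam → μ} ∈ A_{r+1}` -/
  d : ∀ r, toCellularTower.Shape r → toCellularTower.Shape (r + 1) → alg (r + 1)
  /-- if `lam` is the label of the `i`-th layer of the filtration of `Δ_{r+1}(μ)`, then
  `δ(μ) d_{lam → μ}` lies in that layer and represents the generator `δ(lam)` -/
  d_spec : ∀ r (μ : toCellularTower.Shape (r + 1)) (i : Fin (filt r μ).len),
    ∃ h : (datum (r + 1)).act μ (d r ((filt r μ).label i) μ) (δ (r + 1) μ) ∈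
        (filt r μ).N i.succ,
      (filt r μ).iso i (Submodule.Quotient.mk ⟨_, h⟩) = δ r ((filt r μ).label i)
  /-- the branching factors `u_{lam → μ} ∈ A_{r+1}` -/
  u : ∀ r, toCellularTower.Shape r → toCellularTower.Shape (r + 1) → alg (r + 1)
  compat : ∀ r lam μ, toCellularTower.Edge r lam μ →
    (m (r + 1) μ : B) * d r lam μ = inv.toLin (u r lam μ : B) * m r lam

namespace DiagramAlgebras

variable {R : Type u} {B : Type v} [CommRing R] [IsDomain R] [Ring B] [Algebra R B]
  (T : DiagramAlgebras.{u, v, w, w'} R B)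

/-- `u_{t(s) → t(s+1)} ⋯ u_{t(s+k-1) → t(s+k)}`. -/
def uPartial {s r : ℕ} (t : T.SkewPath s r) : (k : ℕ) → s + k ≤ r → B
  | 0, _ => 1
  | k + 1, h => uPartial t k ((s + k).le_succ.trans h) *
      T.u (s + k) (t.vertex ⟨s + k, Nat.le_add_right s k, (s + k).le_succ.trans h⟩)
        (t.vertex ⟨s + k + 1, Nat.le_add_right s (k + 1), h⟩)

/-- `u_t = u_{t(s) → t(s+1)} ⋯ u_{t(r-1) → t(r)}` for a path `t` from level `s` to level `r`. -/
def uPath {s r : ℕ} (hsr : s ≤ r) (t : T.SkewPath s r) : B :=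
  T.uPartial t (r - s) (Nat.add_sub_cancel' hsr).le

/-- `u_t^*`. -/
def uStar {s r : ℕ} (hsr : s ≤ r) (t : T.SkewPath s r) : B :=
  T.inv.toLin (T.uPath hsr t)

end DiagramAlgebras

/-! Write λ = t(s). Each u^*_p, for p a path from ∅ to λ, has the form m_λ b, so the error in the
hypothesis is m_λ y for some y ∈ A_s, and it lies in A_s^{▷λ}. Since u^*_t = u^*_{t[s,r]}
u^*_{t[0,s]}, only u^*_{t[s,r]} m_λ y has to be expanded. Modulo A_r^{▷ν}, a product m_ν b is
determined by the vector δ(ν)b (`mul_mem_above_iff`), so the expansion can take place in Δ_r(ν).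

Let U_j be the upper set of shapes allowed at level j (`dominatingShapes`). Semisimplicity over the
fraction field yields e_j in the cell ideal of U_j and q_j ≠ 0 with x e_j = q_j x on that ideal
(`exists_scaled_right_identity`). The vectors of Δ_r(ν) on which every e_j with j ≤ r acts as q_j
are exactly the R-combinations of the path vectors whose paths stay in the U_j
(`act_of_mem_span_pathVectors`, `mem_span_pathVectors`). The error vector satisfies these equations,
checked level by level in `uStar_mul_m_mul_mem`. The fraction field serves only to produce the e_j,
so all coefficients stay in R. -/

/-! ### Right identities of ideals, up to a scalar. -/

theorem IsSplitSemisimple.isSemisimpleRing {F S : Type*} [Field F] [Ring S] [Algebra F S]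
    (h : IsSplitSemisimple F S) : IsSemisimpleRing S := by
  obtain ⟨n, d, -, ⟨e⟩⟩ := h
  exact e.symm.toRingEquiv.isSemisimpleRing

/-- If the scalar extension of `A` to the fraction field is semisimple, then every left ideal of
`A` contains a right identity up to a nonzero scalar. -/
theorem exists_scaled_right_identity {R : Type*} {A : Type*} [CommRing R] [IsDomain R] [Ring A]
    [Algebra R A] [Module.Flat R A] [IsSemisimpleRing (FractionRing R ⊗[R] A)]
    (I : Submodule R A) (hI : ∀ (b : A), ∀ x ∈ I, b * x ∈ I) :
    ∃ (q : R) (e : A), q ≠ 0 ∧ e ∈ I ∧ ∀ x ∈ I, x * e = q • x := by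
  let ι : A →ₐ[R] FractionRing R ⊗[R] A := Algebra.TensorProduct.includeRight
  have hι : Function.Injective ι :=
    Algebra.TensorProduct.includeRight_injective (IsFractionRing.injective R (FractionRing R))
  let J : Ideal (FractionRing R ⊗[R] A) := Ideal.span (ι '' I)
  -- Clearing denominators: some nonzero R-multiple of each element of J comes from I.
  have key : ∀ y ∈ J, ∃ (q : R) (e : A), q ≠ 0 ∧ e ∈ I ∧ q • y = ι e := by
    intro y hy
    refine Submodule.span_induction
      (p := fun y _ => ∃ (q : R) (e : A), q ≠ 0 ∧ e ∈ I ∧ q • y = ι e) ?_ ?_ ?_ ?_ hy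
    · rintro _ ⟨x, hx, rfl⟩
      exact ⟨1, x, one_ne_zero, hx, one_smul _ _⟩
    · exact ⟨1, 0, one_ne_zero, I.zero_mem, by simp⟩
    · rintro y z _ _ ⟨q, e, hq, he, h⟩ ⟨q', e', hq', he', h'⟩
      refine ⟨q * q', q' • e + q • e', mul_ne_zero hq hq',
        I.add_mem (I.smul_mem _ he) (I.smul_mem _ he'), ?_⟩
      rw [map_add, map_smul, map_smul, ← h, ← h', smul_add, smul_smul, smul_smul, mul_comm q']
    · rintro s y _ ⟨q, e, hq, he, h⟩
      induction s using TensorProduct.induction_on with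
      | zero => exact ⟨1, 0, one_ne_zero, I.zero_mem, by simp⟩
      | tmul f a =>
        obtain ⟨p, t, ht, rfl⟩ := IsFractionRing.div_surjective (A := R) f
        have ht0 : t ≠ 0 := nonZeroDivisors.ne_zero ht
        have hf : t • (algebraMap R (FractionRing R) p / algebraMap R (FractionRing R) t) =
            p • (1 : FractionRing R) := by
          have : algebraMap R (FractionRing R) t ≠ 0 := by
            simpa using ht0
          rw [Algebra.smul_def, Algebra.smul_def, mul_div_cancel₀ _ this, mul_one]
        refine ⟨t * q, p • (a * e), mul_ne_zero ht0 hq, I.smul_mem _ (hI a e he), ?_⟩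
        rw [smul_eq_mul, ← smul_mul_smul_comm, h, TensorProduct.smul_tmul', hf,
          ← TensorProduct.smul_tmul', map_smul, map_mul, smul_mul_assoc]
        rfl
      | add s s' h1 h2 =>
        obtain ⟨q, e, hq, he, h⟩ := h1
        obtain ⟨q', e', hq', he', h'⟩ := h2
        refine ⟨q * q', q' • e + q • e', mul_ne_zero hq hq',
          I.add_mem (I.smul_mem _ he) (I.smul_mem _ he'), ?_⟩
        rw [map_add, map_smul, map_smul, ← h, ← h', add_smul, smul_add, smul_smul, smul_smul,
          mul_comm q']
  -- J is generated as a left ideal by an idempotent f, which is therefore a right identity on J; e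
  -- is the integral multiple q f.
  obtain ⟨f, hf, hJ⟩ := IsSemisimpleRing.ideal_eq_span_idempotent J
  obtain ⟨q, e, hq, he, h⟩ := key f (hJ ▸ Ideal.mem_span_singleton_self f)
  refine ⟨q, e, hq, he, fun x hx => hι ?_⟩
  have hxJ : ι x ∈ Ideal.span {f} := hJ ▸ Ideal.subset_span ⟨x, hx, rfl⟩
  obtain ⟨y, hy⟩ := Ideal.mem_span_singleton'.1 hxJ
  have hxf : ι x * f = ι x := by rw [← hy, mul_assoc, hf.eq]
  rw [map_mul, ← h, mul_smul_comm, hxf, map_smul]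

theorem AlgInvolution.map_one {R A : Type*} [CommRing R] [Ring A] [Algebra R A]
    (i : AlgInvolution R A) : i.toLin 1 = 1 := by
  have h := i.map_mul (i.toLin 1) 1
  rwa [mul_one, i.invol, mul_one, eq_comm] at h

/-! ### Cell ideals and the action on cell modules. -/

namespace CellDatum

variable {R : Type u} {A : Type v} [CommRing R] [Ring A] [Algebra R A]
  (D : CellDatum.{u, v, w, w'} R A)

/-- The span of the cellular basis elements whose shape lies in `U`. -/
def shapeSpan (U : Set D.Shape) : Submodule R A :=
  Submodule.span R {x | ∃ (μ : D.Shape) (p q : D.Idx μ), μ ∈ U ∧ x = D.basis ⟨μ, p, q⟩}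

theorem shapeSpan_mono {U V : Set D.Shape} (h : U ⊆ V) : D.shapeSpan U ≤ D.shapeSpan V :=
  Submodule.span_mono fun _ ⟨μ, p, q, hμ, hx⟩ => ⟨μ, p, q, h hμ, hx⟩

theorem atLeast_le_shapeSpan {U : Set D.Shape} (hU : IsUpperSet U) {μ : D.Shape} (hμ : μ ∈ U) :
    D.atLeast μ ≤ D.shapeSpan U :=
  D.shapeSpan_mono fun _ h => hU h hμ

theorem mul_mem_shapeSpan {U : Set D.Shape} (hU : IsUpperSet U) {x : A} (hx : x ∈ D.shapeSpan U)
    (a : A) : x * a ∈ D.shapeSpan U := by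
  refine Submodule.span_induction (p := fun x _ => x * a ∈ D.shapeSpan U) ?_ ?_ ?_ ?_ hx
  · rintro x ⟨μ, p, q, hμ, rfl⟩
    exact D.atLeast_le_shapeSpan hU hμ
      (D.mul_right_mem (Submodule.subset_span ⟨μ, p, q, le_rfl, rfl⟩) a)
  · simp
  · intro x y _ _ hx hy
    rw [add_mul]
    exact Submodule.add_mem _ hx hy
  · intro c x _ hx
    rw [smul_mul_assoc]
    exact Submodule.smul_mem _ _ hx

theorem mul_mem_shapeSpan_left {U : Set D.Shape} (hU : IsUpperSet U) (b : A) {x : A}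
    (hx : x ∈ D.shapeSpan U) : b * x ∈ D.shapeSpan U := by
  refine Submodule.span_induction (p := fun x _ => b * x ∈ D.shapeSpan U) ?_ ?_ ?_ ?_ hx
  · rintro x ⟨μ, p, q, hμ, rfl⟩
    exact D.atLeast_le_shapeSpan hU hμ
      (D.mul_left_mem (Submodule.subset_span ⟨μ, p, q, le_rfl, rfl⟩) b)
  · simp
  · intro x y _ _ hx hy
    rw [mul_add]
    exact Submodule.add_mem _ hx hy
  · intro c x _ hx
    rw [mul_smul_comm]
    exact Submodule.smul_mem _ _ hx

theorem repr_eq_zero {U : Set D.Shape} {x : A} (hx : x ∈ D.shapeSpan U) {μ : D.Shape}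
    (hμ : μ ∉ U) (p q : D.Idx μ) : D.basis.repr x ⟨μ, p, q⟩ = 0 := by
  refine Submodule.span_induction (p := fun x _ => D.basis.repr x ⟨μ, p, q⟩ = 0) ?_ ?_ ?_ ?_ hx
  · rintro x ⟨κ, p', q', hκ, rfl⟩
    rw [Module.Basis.repr_self, Finsupp.single_apply_eq_zero]
    rintro h
    cases h
    exact absurd hκ hμ
  · simp
  · intro x y _ _ hx hy
    simp [hx, hy]
  · intro c x _ hx
    simp [hx]

theorem shapeSpan_univ : D.shapeSpan Set.univ = ⊤ := by
  rw [eq_top_iff, ← D.basis.span_eq]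
  refine Submodule.span_mono ?_
  rintro _ ⟨⟨μ, p, q⟩, rfl⟩
  exact ⟨μ, p, q, trivial, rfl⟩

theorem basis_mul_sub_mem (lam : D.Shape) (s t : D.Idx lam) (a : A) :
    D.basis ⟨lam, s, t⟩ * a - ∑ v, D.coeff lam a t v • D.basis ⟨lam, s, v⟩ ∈ D.above lam := by
  classical
  obtain ⟨c, hc⟩ := D.mul_basis lam t a
  have h : ∀ v, c v = D.coeff lam a t v := by
    intro v
    -- The c v do not depend on the first index, so they may be read off at t, where they are the
    -- entries of `coeff`.
    have h := D.repr_eq_zero (U := Set.Ioi lam) (hc t) (lt_irrefl lam) t v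
    rw [map_sub, Finsupp.sub_apply, sub_eq_zero] at h
    rw [coeff, h, map_sum, Finsupp.finsetSum_apply, Finset.sum_eq_single v]
    · simp
    · intro b _ hb
      have : (⟨lam, t, b⟩ : Σ lam : D.Shape, D.Idx lam × D.Idx lam) ≠ ⟨lam, t, v⟩ := by
        intro h
        simp at h
        exact hb h
      simp [Finsupp.single_eq_of_ne this.symm]
    · simp
  simp only [← h]
  exact hc s

theorem coeff_mul (lam : D.Shape) (a b : A) :
    D.coeff lam (a * b) = D.coeff lam a * D.coeff lam b := by
  classical
  ext t v
  have h1 := D.mul_mem_shapeSpan (U := Set.Ioi lam) (isUpperSet_Ioi lam)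
    (D.basis_mul_sub_mem lam t t a) b
  have h2 := D.repr_eq_zero h1 (lt_irrefl lam) t v
  rw [sub_mul, map_sub, Finsupp.sub_apply, sub_eq_zero, mul_assoc] at h2
  rw [coeff, h2, Finset.sum_mul, map_sum, Finsupp.finsetSum_apply, Matrix.mul_apply]
  refine Finset.sum_congr rfl fun x _ => ?_
  have h3 := D.repr_eq_zero (U := Set.Ioi lam) (D.basis_mul_sub_mem lam t x b)
    (lt_irrefl lam) t v
  rw [map_sub, Finsupp.sub_apply, sub_eq_zero] at h3
  rw [smul_mul_assoc, map_smul, Finsupp.smul_apply, smul_eq_mul, h3, map_sum,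
    Finsupp.finsetSum_apply, Finset.sum_eq_single v]
  · simp
  · intro b _ hb
    have : (⟨lam, t, b⟩ : Σ lam : D.Shape, D.Idx lam × D.Idx lam) ≠ ⟨lam, t, v⟩ := by
      intro h
      simp at h
      exact hb h
    simp [Finsupp.single_eq_of_ne this.symm]
  · simp

theorem act_mul (lam : D.Shape) (a b : A) (x : D.CellModule lam) :
    D.act lam (a * b) x = D.act lam b (D.act lam a x) := by
  simp [act, coeff_mul, Matrix.vecMul_vecMul]

theorem act_one (lam : D.Shape) (x : D.CellModule lam) : D.act lam 1 x = x := by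
  classical
  have : D.coeff lam 1 = 1 := by
    ext t v
    simp [coeff, Matrix.one_apply, Finsupp.single_apply]
  simp [act, this]

theorem act_add (lam : D.Shape) (a b : A) (x : D.CellModule lam) :
    D.act lam (a + b) x = D.act lam a x + D.act lam b x := by
  have : D.coeff lam (a + b) = D.coeff lam a + D.coeff lam b := by
    ext t v
    simp [coeff, mul_add]
  simp [act, this]

theorem act_smul (lam : D.Shape) (c : R) (a : A) (x : D.CellModule lam) :
    D.act lam (c • a) x = c • D.act lam a x := by
  have : D.coeff lam (c • a) = c • D.coeff lam a := by
    ext t v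
    simp [coeff]
  simp [act, this]

/-- The action on a fixed vector, as a linear map in the algebra element. -/
noncomputable def orbitMap (lam : D.Shape) (x : D.CellModule lam) : A →ₗ[R] D.CellModule lam where
  toFun a := D.act lam a x
  map_add' a b := D.act_add lam a b x
  map_smul' c a := D.act_smul lam c a x

/-- Multiplying a basis element by a lands in the ideal of U, which has no coordinates at shapes
outside U. -/
theorem act_eq_zero {U : Set D.Shape} (hU : IsUpperSet U) {lam : D.Shape} (hlam : lam ∉ U) {a : A}
    (ha : a ∈ D.shapeSpan U) (x : D.CellModule lam) : D.act lam a x = 0 := by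
  have : D.coeff lam a = 0 := by
    ext t v
    exact D.repr_eq_zero (D.mul_mem_shapeSpan_left hU _ ha) hlam t v
  simp [act, this]

variable {D} in
/-- If `m` represents `δ ⊗ δ` under the bimodule isomorphism, then `m b` lies in `A^{▷ lam}` exactly
when `b` annihilates `δ`. -/
theorem CellBimoduleIso.mul_mem_above_iff [IsDomain R] {lam : D.Shape} (α : D.CellBimoduleIso lam)
    {m : A} (hm : m ∈ D.atLeast lam) {δ : D.CellModule lam} (hδ : δ ≠ 0)
    (h : α.equiv (Submodule.Quotient.mk ⟨m, hm⟩) = δ ⊗ₜ[R] δ) (b : A) :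
    m * b ∈ D.above lam ↔ D.act lam b δ = 0 := by
  have h1 := α.map_mul 1 b ⟨m, hm⟩
  rw [h, TensorProduct.map_tmul, D.inv.map_one, act_one] at h1
  have h2 : m * b ∈ D.above lam ↔ δ ⊗ₜ[R] D.act lam b δ = 0 := by
    rw [← h1, LinearEquiv.map_eq_zero_iff, Submodule.Quotient.mk_eq_zero]
    simp [Submodule.submoduleOf]
  rw [h2]
  refine ⟨fun h0 => ?_, fun h0 => by simp [h0]⟩
  -- Contracting the first tensor factor with a nonzero coordinate of δ leaves a nonzero multiple of
  -- δ b, and R is a domain.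
  obtain ⟨i, hi⟩ := Function.ne_iff.1 hδ
  have h3 := congrArg ((TensorProduct.lid R (D.CellModule lam)).toLinearMap ∘ₗ
    TensorProduct.map (LinearMap.proj (R := R) (φ := fun _ : D.Idx lam => R) i)
      (LinearMap.id (R := R) (M := D.CellModule lam))) h0
  simp only [LinearMap.comp_apply, TensorProduct.map_tmul, LinearMap.proj_apply,
    LinearMap.id_apply, LinearEquiv.coe_coe, TensorProduct.lid_tmul, map_zero] at h3
  exact (smul_eq_zero.1 h3).resolve_left hi

theorem exists_scaled_right_identity [IsDomain R]
    (h : IsSplitSemisimple (FractionRing R) (FractionRing R ⊗[R] A)) {U : Set D.Shape}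
    (hU : IsUpperSet U) :
    ∃ (q : R) (e : A), q ≠ 0 ∧ e ∈ D.shapeSpan U ∧ ∀ x ∈ D.shapeSpan U, x * e = q • x := by
  have := h.isSemisimpleRing
  have : Module.Free R A := .of_basis D.basis
  exact _root_.exists_scaled_right_identity (D.shapeSpan U)
    fun b _ hx => D.mul_mem_shapeSpan_left hU b hx

end CellDatum

/-! ### Extending paths by an edge. -/

namespace CellularTower.SkewPath

variable {R : Type u} {B : Type v} [CommRing R] [Ring B] [Algebra R B]
  {T : CellularTower.{u, v, w, w'} R B}

/-- The extension of a path by an edge at its end. -/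
def snoc {r : ℕ} (z : T.SkewPath 0 r) (μ : T.Shape (r + 1))
    (h : T.Edge r (z.vertex ⟨r, Nat.zero_le r, le_rfl⟩) μ) : T.SkewPath 0 (r + 1) where
  vertex j := if hj : j.1 ≤ r then z.vertex ⟨j, j.2.1, hj⟩ else
    cast (congrArg T.Shape (le_antisymm (not_le.1 hj) j.2.2)) μ
  edge j h0 h' := by
    rcases (Nat.succ_le_succ_iff.1 h').lt_or_eq with hj | rfl
    · simpa only [dif_pos hj.le, dif_pos (Nat.succ_le_of_lt hj)] using z.edge j h0 hj
    · simpa using h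

theorem snoc_vertex_of_le {r : ℕ} (z : T.SkewPath 0 r) (μ : T.Shape (r + 1))
    (h : T.Edge r (z.vertex ⟨r, Nat.zero_le r, le_rfl⟩) μ) (j : ℕ) (hj : j ≤ r) :
    (z.snoc μ h).vertex ⟨j, Nat.zero_le j, hj.trans r.le_succ⟩ =
      z.vertex ⟨j, Nat.zero_le j, hj⟩ :=
  dif_pos hj

theorem snoc_vertex_last {r : ℕ} (z : T.SkewPath 0 r) (μ : T.Shape (r + 1))
    (h : T.Edge r (z.vertex ⟨r, Nat.zero_le r, le_rfl⟩) μ) :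
    (z.snoc μ h).vertex ⟨r + 1, Nat.zero_le _, le_rfl⟩ = μ := by
  simp [snoc]

theorem trunc_snoc {r : ℕ} (z : T.SkewPath 0 r) (μ : T.Shape (r + 1))
    (h : T.Edge r (z.vertex ⟨r, Nat.zero_le r, le_rfl⟩) μ) :
    (z.snoc μ h).trunc 0 r le_rfl r.le_succ = z := by
  ext j
  exact z.snoc_vertex_of_le μ h j j.2.2

end CellularTower.SkewPath

/-! ### Products of branching factors along paths. -/

namespace DiagramAlgebras

variable {R : Type u} {B : Type v} [CommRing R] [IsDomain R] [Ring B] [Algebra R B]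
  (T : DiagramAlgebras.{u, v, w, w'} R B)

theorem δ_ne_zero (r : ℕ) (lam : T.Shape r) : T.δ r lam ≠ 0 := by
  intro h
  obtain ⟨i⟩ := (T.datum r).idxNonempty lam
  obtain ⟨a, ha⟩ := T.cyclic r lam (fun _ => 1)
  rw [h, map_zero] at ha
  exact zero_ne_one (congrFun ha i)

theorem m_mul_mem_above_iff {r : ℕ} {lam : T.Shape r} (b : T.alg r) :
    T.m r lam * b ∈ (T.datum r).above lam ↔ (T.datum r).act lam b (T.δ r lam) = 0 :=
  (T.α r lam).mul_mem_above_iff (T.m_mem r lam) (T.δ_ne_zero r lam) (T.α_m r lam) b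

/-- Turns an eigenvalue equation for right multiplication in the algebra into one in the cell
module. -/
theorem act_δ_eq_smul {r : ℕ} {lam : T.Shape r} {a b : T.alg r} {q : R}
    (h : (T.m r lam * a : B) * b = q • (T.m r lam * a : B)) :
    (T.datum r).act lam b ((T.datum r).act lam a (T.δ r lam)) =
      q • (T.datum r).act lam a (T.δ r lam) := by
  have h1 : T.m r lam * (a * b - q • a) = 0 := by
    rw [mul_sub, ← mul_assoc, mul_smul_comm, sub_eq_zero]
    exact Subtype.ext h
  have h2 := T.m_mul_mem_above_iff (lam := lam) (a * b - q • a)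
  rw [h1] at h2
  have h3 := h2.1 (Submodule.zero_mem _)
  rw [sub_eq_add_neg, ← neg_smul, CellDatum.act_add, CellDatum.act_smul, CellDatum.act_mul,
    neg_smul, ← sub_eq_add_neg, sub_eq_zero] at h3
  exact h3

theorem uPartial_trunc {s r : ℕ} (t : T.SkewPath s (r + 1)) (k : ℕ) (h : s + k ≤ r) :
    T.uPartial (t.trunc s r le_rfl r.le_succ) k h = T.uPartial t k (h.trans r.le_succ) := by
  induction k with
  | zero => rfl
  | succ k ih =>
    rw [uPartial, uPartial, ih]
    rfl

theorem uPath_eq_uPartial {s r : ℕ} (hsr : s ≤ r) (t : T.SkewPath s r) (k : ℕ) (h : s + k = r) :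
    T.uPath hsr t = T.uPartial t k h.le := by
  obtain rfl : k = r - s := by omega
  rfl

theorem uPath_self {s : ℕ} (t : T.SkewPath s s) : T.uPath le_rfl t = 1 :=
  T.uPath_eq_uPartial le_rfl t 0 rfl

theorem uPath_succ {s r : ℕ} (hsr : s ≤ r) (t : T.SkewPath s (r + 1)) :
    T.uPath (hsr.trans r.le_succ) t = T.uPath hsr (t.trunc s r le_rfl r.le_succ) *
      T.u r (t.vertex ⟨r, hsr, r.le_succ⟩) (t.vertex ⟨r + 1, hsr.trans r.le_succ, le_rfl⟩) := by
  obtain ⟨k, rfl⟩ := Nat.exists_eq_add_of_le hsr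
  rw [T.uPath_eq_uPartial _ t (k + 1) rfl, T.uPath_eq_uPartial _ _ k rfl, uPartial_trunc]
  rfl

theorem uPath_split {s p r : ℕ} (hsp : s ≤ p) (hpr : p ≤ r) (t : T.SkewPath s r) :
    T.uPath (hsp.trans hpr) t = T.uPath hsp (t.trunc s p le_rfl hpr) *
      T.uPath hpr (t.trunc p r hsp le_rfl) := by
  induction r, hpr using Nat.le_induction with
  | base =>
    rw [uPath_self, mul_one]
    rfl
  | succ r hpr ih =>
    rw [T.uPath_succ (hsp.trans hpr), T.uPath_succ hpr, ih, mul_assoc]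
    rfl

theorem uStar_self {s : ℕ} (t : T.SkewPath s s) : T.uStar le_rfl t = 1 := by
  rw [uStar, uPath_self, AlgInvolution.map_one]

theorem uStar_succ {s r : ℕ} (hsr : s ≤ r) (t : T.SkewPath s (r + 1)) :
    T.uStar (hsr.trans r.le_succ) t = T.inv.toLin
      (T.u r (t.vertex ⟨r, hsr, r.le_succ⟩) (t.vertex ⟨r + 1, hsr.trans r.le_succ, le_rfl⟩)) *
        T.uStar hsr (t.trunc s r le_rfl r.le_succ) := by
  rw [uStar, T.uPath_succ hsr, AlgInvolution.map_mul]
  rfl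

theorem uStar_split {s p r : ℕ} (hsp : s ≤ p) (hpr : p ≤ r) (t : T.SkewPath s r) :
    T.uStar (hsp.trans hpr) t = T.uStar hpr (t.trunc p r hsp le_rfl) *
      T.uStar hsp (t.trunc s p le_rfl hpr) := by
  rw [uStar, T.uPath_split hsp hpr, AlgInvolution.map_mul]
  rfl

/-- For each edge λ → μ, `compat` replaces u^* m_λ by m_μ d, so m climbs the path from its bottom to
its top vertex. -/
theorem exists_uStar_mul_m {s r : ℕ} (hsr : s ≤ r) (t : T.SkewPath s r) {ν : T.Shape r}
    (hν : t.vertex ⟨r, hsr, le_rfl⟩ = ν) :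
    ∃ a : T.alg r, T.uStar hsr t * T.m s (t.vertex ⟨s, le_rfl, hsr⟩) = T.m r ν * a := by
  subst hν
  induction r, hsr using Nat.le_induction with
  | base => exact ⟨1, by rw [uStar_self]; simp⟩
  | succ r hsr ih =>
    obtain ⟨a, ha⟩ := ih (t.trunc s r le_rfl r.le_succ)
    have h1 := T.compat r _ _ (t.edge r hsr le_rfl)
    refine ⟨T.d r (t.vertex ⟨r, hsr, r.le_succ⟩) (t.vertex ⟨r + 1, hsr.trans r.le_succ, le_rfl⟩) *
      Subalgebra.inclusion (T.alg_mono r.le_succ) a, ?_⟩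
    rw [T.uStar_succ hsr, mul_assoc]
    refine (congrArg _ ha).trans ?_
    rw [← mul_assoc]
    refine (congrArg (· * (a : B)) h1.symm).trans ?_
    simp [mul_assoc]

theorem exists_uStar_eq {r : ℕ} (t : T.SkewPath 0 r) {ν : T.Shape r}
    (hν : t.vertex ⟨r, Nat.zero_le r, le_rfl⟩ = ν) :
    ∃ a : T.alg r, T.uStar (Nat.zero_le r) t = T.m r ν * a := by
  obtain ⟨a, ha⟩ := T.exists_uStar_mul_m (Nat.zero_le r) t hν
  refine ⟨a, ?_⟩
  rw [← ha, T.m_zero]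
  simp

/-- The part of the product up to level p is m_{t(p)} times an element of A_p, hence lies in the
ideal of U. The remaining factor u^*_{t[p,r]} stands on the left and does not interfere with e. -/
theorem uStar_mul_eq_smul {s p r : ℕ} (hsp : s ≤ p) (hpr : p ≤ r) (t : T.SkewPath s r)
    (y : T.alg s) {U : Set (T.Shape p)} (hU : IsUpperSet U)
    (ht : t.vertex ⟨p, hsp, hpr⟩ ∈ U) {q : R} {e : T.alg p}
    (he : ∀ x ∈ (T.datum p).shapeSpan U, x * e = q • x) :
    T.uStar (hsp.trans hpr) t * (T.m s (t.vertex ⟨s, le_rfl, hsp.trans hpr⟩) * y) * e =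
      q • (T.uStar (hsp.trans hpr) t * (T.m s (t.vertex ⟨s, le_rfl, hsp.trans hpr⟩) * y)) := by
  obtain ⟨a, ha⟩ := T.exists_uStar_mul_m hsp (t.trunc s p le_rfl hpr) rfl
  have hx : T.uStar hsp (t.trunc s p le_rfl hpr) *
      ((T.m s (t.vertex ⟨s, le_rfl, hsp.trans hpr⟩) : B) * y) =
      ((T.m p (t.vertex ⟨p, hsp, hpr⟩) * (a * Subalgebra.inclusion (T.alg_mono hsp) y) :
        T.alg p) : B) := by
    rw [← mul_assoc]
    refine (congrArg (· * (y : B)) ha).trans ?_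
    simp only [MulMemClass.coe_mul, Subalgebra.coe_inclusion, mul_assoc]
    rfl
  have h1 := congrArg (Subtype.val : T.alg p → B) (he _ ((T.datum p).mul_mem_shapeSpan hU
    ((T.datum p).atLeast_le_shapeSpan hU ht (T.m_mem p _))
    (a * Subalgebra.inclusion (T.alg_mono hsp) y)))
  rw [T.uStar_split hsp hpr, mul_assoc (T.uStar hpr _), hx, mul_assoc, ← mul_smul_comm]
  exact congrArg _ h1

/-! ### Path vectors as simultaneous eigenvectors. -/

/-- The elements `δ(ν) d_z` of the cell module, for the paths `z` to `ν` whose vertices lie in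
prescribed sets of shapes. -/
def pathVectors (U : ∀ j, Set (T.Shape j)) (r : ℕ) (ν : T.Shape r) : Set (T.Cell r ν) :=
  {v | ∃ (z : T.SkewPath 0 r) (a : T.alg r), z.vertex ⟨r, Nat.zero_le r, le_rfl⟩ = ν ∧
    (∀ (j : ℕ) (hj : j ≤ r), z.vertex ⟨j, Nat.zero_le j, hj⟩ ∈ U j) ∧
    T.uStar (Nat.zero_le r) z = T.m r ν * a ∧ v = (T.datum r).act ν a (T.δ r ν)}

section Span

variable {T} {U : ∀ j, Set (T.Shape j)} (hU : ∀ j, IsUpperSet (U j)) {q : ℕ → R}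
  {e : ∀ j, T.alg j} (he : ∀ j, ∀ x ∈ (T.datum j).shapeSpan (U j), x * e j = q j • x)

include hU he in
theorem act_of_mem_span_pathVectors {r : ℕ} {ν : T.Shape r} {x : T.Cell r ν}
    (hx : x ∈ Submodule.span R (T.pathVectors U r ν)) (j : ℕ) (hj : j ≤ r) :
    (T.datum r).act ν (Subalgebra.inclusion (T.alg_mono hj) (e j)) x = q j • x := by
  refine Submodule.span_induction (p := fun x _ => (T.datum r).act ν
    (Subalgebra.inclusion (T.alg_mono hj) (e j)) x = q j • x) ?_ ?_ ?_ ?_ hx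
  · rintro _ ⟨z, a, -, hz, ha, rfl⟩
    refine T.act_δ_eq_smul ?_
    have h := T.uStar_mul_eq_smul (Nat.zero_le j) hj z 1 (hU j) (hz j hj) (he j)
    rw [T.m_zero, OneMemClass.coe_one, mul_one, mul_one, ha] at h
    exact h
  · simp
  · intro x y _ _ hx hy
    rw [map_add, hx, hy, smul_add]
  · intro c x _ hx
    rw [map_smul, hx, smul_comm]

/-- Appending the edge to ν lifts a path vector of a layer: by `d_spec`, δ(ν) d represents the
generator of that layer. -/
theorem exists_lift_of_mem_span_pathVectors {r : ℕ} {ν : T.Shape (r + 1)} (hν : ν ∈ U (r + 1))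
    (i : Fin (T.filt r ν).len) {x : T.Cell r ((T.filt r ν).label i)}
    (hx : x ∈ Submodule.span R (T.pathVectors U r ((T.filt r ν).label i))) :
    ∃ y : (T.filt r ν).N i.succ, (y : T.Cell (r + 1) ν) ∈
      Submodule.span R (T.pathVectors U (r + 1) ν) ∧
      (T.filt r ν).iso i (Submodule.Quotient.mk y) = x := by
  refine Submodule.span_induction (p := fun x _ => ∃ y : (T.filt r ν).N i.succ,
    (y : T.Cell (r + 1) ν) ∈ Submodule.span R (T.pathVectors U (r + 1) ν) ∧
      (T.filt r ν).iso i (Submodule.Quotient.mk y) = x) ?_ ?_ ?_ ?_ hx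
  · rintro _ ⟨z, a, hz, hzU, ha, rfl⟩
    obtain ⟨h, hδ⟩ := T.d_spec r ν i
    have hE : T.Edge r ((T.filt r ν).label i) ν := ⟨T.filt r ν, i, rfl⟩
    have h1 := (T.filt r ν).iso_act i a ⟨_, h⟩
    rw [hδ] at h1
    refine ⟨_, Submodule.subset_span ⟨z.snoc ν (hz ▸ hE), T.d r ((T.filt r ν).label i) ν *
      Subalgebra.inclusion (T.alg_mono r.le_succ) a, z.snoc_vertex_last _ _, ?_, ?_, ?_⟩, h1⟩
    · intro j hj
      rcases Nat.le_succ_iff.1 hj with hj' | rfl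
      · rw [z.snoc_vertex_of_le _ _ j hj']
        exact hzU j hj'
      · rw [z.snoc_vertex_last]
        exact hν
    · rw [T.uStar_succ (Nat.zero_le r), z.trunc_snoc, ha, z.snoc_vertex_last,
        z.snoc_vertex_of_le _ _ r le_rfl, hz, ← mul_assoc, ← T.compat r _ _ hE]
      simp [mul_assoc]
    · rw [CellDatum.act_mul]
      rfl
  · exact ⟨0, Submodule.zero_mem _, by simp⟩
  · rintro x x' _ _ ⟨y, hy, rfl⟩ ⟨y', hy', rfl⟩
    exact ⟨y + y', Submodule.add_mem _ hy hy', by simp⟩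
  · rintro c x _ ⟨y, hy, rfl⟩
    exact ⟨c • y, Submodule.smul_mem _ c hy, by simp⟩

/-- If ν is not in U_r, then e_r kills Δ_r(ν), while q_r ≠ 0. -/
theorem vertex_mem_or_eq_zero (hU : ∀ j, IsUpperSet (U j)) (hq : ∀ j, q j ≠ 0)
    (he' : ∀ j, e j ∈ (T.datum j).shapeSpan (U j)) {r : ℕ} {ν : T.Shape r} {x : T.Cell r ν}
    (hx : (T.datum r).act ν (e r) x = q r • x) : ν ∈ U r ∨ x = 0 := by
  refine or_iff_not_imp_left.2 fun hν => ?_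
  rw [CellDatum.act_eq_zero _ (hU r) hν (he' r)] at hx
  exact (smul_eq_zero.1 hx.symm).resolve_left (hq r)

include hU he in
-- Induction on the level and, inside it, along the filtration of the restricted cell module. The
-- equations pass to each layer, and subtracting a lift of the class in the top layer preserves
-- them.
theorem mem_span_pathVectors (hq : ∀ j, q j ≠ 0)
    (he' : ∀ j, e j ∈ (T.datum j).shapeSpan (U j)) {r : ℕ} {ν : T.Shape r} {x : T.Cell r ν}
    (hx : ∀ (j : ℕ) (hj : j ≤ r),
      (T.datum r).act ν (Subalgebra.inclusion (T.alg_mono hj) (e j)) x = q j • x) :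
    x ∈ Submodule.span R (T.pathVectors U r ν) := by
  rcases vertex_mem_or_eq_zero hU hq he' (hx r le_rfl) with hν | rfl
  swap
  · exact Submodule.zero_mem _
  induction r with
  | zero =>
    -- Since A_0 = R, the module is R δ, and δ is the vector of the path of length zero.
    obtain ⟨a, rfl⟩ := T.cyclic 0 ν x
    obtain ⟨c, rfl⟩ := T.alg_zero.2 a
    rw [Algebra.algebraMap_eq_smul_one, CellDatum.act_smul]
    refine Submodule.smul_mem _ _ (Submodule.subset_span ⟨⟨fun j =>
      cast (congrArg T.Shape (Nat.le_zero.1 j.2.2).symm) ν, fun j _ h => absurd h (by omega)⟩, 1, rfl, ?_, ?_,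
      rfl⟩)
    · intro j hj
      obtain rfl := Nat.le_zero.1 hj
      exact hν
    · rw [uStar_self, T.m_zero]
      simp
  | succ r ih =>
    have key : ∀ (i : Fin ((T.filt r ν).len + 1)), ∀ x ∈ (T.filt r ν).N i,
        (∀ (j : ℕ) (hj : j ≤ r + 1),
          (T.datum (r + 1)).act ν (Subalgebra.inclusion (T.alg_mono hj) (e j)) x = q j • x) →
        x ∈ Submodule.span R (T.pathVectors U (r + 1) ν) := by
      intro i
      induction i using Fin.induction with
      | zero =>
        intro x hx _
        rw [(T.filt r ν).N_zero, Submodule.mem_bot] at hx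
        rw [hx]
        exact Submodule.zero_mem _
      | succ i ihi =>
        intro x hxN hx
        have hx' : ∀ (j : ℕ) (hj : j ≤ r), (T.datum r).act ((T.filt r ν).label i)
            (Subalgebra.inclusion (T.alg_mono hj) (e j))
            ((T.filt r ν).iso i (Submodule.Quotient.mk ⟨x, hxN⟩)) =
            q j • (T.filt r ν).iso i (Submodule.Quotient.mk ⟨x, hxN⟩) := by
          intro j hj
          rw [← (T.filt r ν).iso_act, ← map_smul, ← Submodule.Quotient.mk_smul]
          congr 2
          exact Subtype.ext (hx j (hj.trans r.le_succ))
        have hspan : (T.filt r ν).iso i (Submodule.Quotient.mk ⟨x, hxN⟩) ∈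
            Submodule.span R (T.pathVectors U r ((T.filt r ν).label i)) := by
          -- A layer whose label is not allowed contributes nothing: the equation for e_r forces the
          -- class to vanish.
          rcases vertex_mem_or_eq_zero hU hq he' (hx' r le_rfl) with hμ | h0
          · exact ih hx' hμ
          · rw [h0]
            exact Submodule.zero_mem _
        obtain ⟨y, hy, hyx⟩ := exists_lift_of_mem_span_pathVectors hν i hspan
        have hsub : x - y ∈ (T.filt r ν).N i.castSucc :=
          (Submodule.Quotient.eq (((T.filt r ν).N i.castSucc).submoduleOf _)).1
            (((T.filt r ν).iso i).injective hyx.symm)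
        -- The lift y is a combination of path vectors, so it satisfies the same equations as x, and
        -- so does x - y, one step lower in the filtration.
        have h1 := ihi _ hsub fun j hj => by
          rw [map_sub, hx j hj, act_of_mem_span_pathVectors hU he hy j hj, smul_sub]
        simpa using Submodule.add_mem _ h1 hy
    exact key (Fin.last _) x (by rw [(T.filt r ν).N_last]; trivial) hx

end Span

theorem exists_sum_of_mem_span_pathVectors {U : ∀ j, Set (T.Shape j)} {r : ℕ} {ν : T.Shape r}
    (P : Finset (T.Std r ν))
    (hP : ∀ z : T.Std r ν, (∀ (j : ℕ) (hj : j ≤ r), z.1.vertex ⟨j, Nat.zero_le j, hj⟩ ∈ U j) →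
      z ∈ P) {x : T.Cell r ν} (hx : x ∈ Submodule.span R (T.pathVectors U r ν)) :
    ∃ (c : T.Std r ν → R) (a : T.alg r), x = (T.datum r).act ν a (T.δ r ν) ∧
      (T.m r ν * a : B) = ∑ z ∈ P, c z • T.uStar (Nat.zero_le r) z.1 := by
  classical
  refine Submodule.span_induction (p := fun x _ => ∃ (c : T.Std r ν → R) (a : T.alg r),
    x = (T.datum r).act ν a (T.δ r ν) ∧
      (T.m r ν * a : B) = ∑ z ∈ P, c z • T.uStar (Nat.zero_le r) z.1) ?_ ?_ ?_ ?_ hx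
  · rintro _ ⟨z, a, hz, hzU, ha, rfl⟩
    obtain ⟨z, rfl⟩ : ∃ z' : T.Std r ν, z'.1 = z := ⟨⟨z, hz⟩, rfl⟩
    refine ⟨Pi.single z 1, a, rfl, ?_⟩
    rw [Finset.sum_eq_single_of_mem _ (hP z hzU)]
    · rw [Pi.single_eq_same, one_smul, ha]
    · intro b _ hb
      simp [Pi.single_eq_of_ne hb]
  · exact ⟨0, 0, ((T.datum r).orbitMap ν (T.δ r ν)).map_zero.symm, by simp⟩
  · rintro _ _ _ _ ⟨c, a, rfl, h⟩ ⟨c', a', rfl, h'⟩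
    exact ⟨c + c', a + a', ((T.datum r).act_add ν a a' _).symm, by
      simp [mul_add, h, h', add_smul, Finset.sum_add_distrib]⟩
  · rintro b _ _ ⟨c, a, rfl, h⟩
    exact ⟨b • c, b • a, ((T.datum r).act_smul ν b a _).symm, by
      simp [h, Finset.smul_sum, smul_smul]⟩

end DiagramAlgebras

/-! ### Expansion of the error term. -/

namespace DiagramAlgebras

variable {R : Type u} {B : Type v} [CommRing R] [IsDomain R] [Ring B] [Algebra R B]
  (T : DiagramAlgebras.{u, v, w, w'} R B)

/-- The shapes at level `j` allowed for a path whose part above level `s` dominates `t`, strictly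
so at level `s`; below level `s` and above level `r` there is no condition. -/
def dominatingShapes {r : ℕ} (s : ℕ) (t : T.SkewPath 0 r) (j : ℕ) : Set (T.Shape j) :=
  {μ | ∀ h : s ≤ j ∧ j ≤ r, t.vertex ⟨j, Nat.zero_le j, h.2⟩ ≤ μ ∧
    (j = s → t.vertex ⟨j, Nat.zero_le j, h.2⟩ < μ)}

theorem isUpperSet_dominatingShapes {r : ℕ} (s : ℕ) (t : T.SkewPath 0 r) (j : ℕ) :
    IsUpperSet (T.dominatingShapes s t j) :=
  fun _ _ h hμ hj => ⟨(hμ hj).1.trans h, fun hs => ((hμ hj).2 hs).trans_le h⟩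

/-- If `m_lam y` lies in `A_s^{▷ lam}` for `lam = t(s)`, then modulo `A_r^{▷ ν}` the element
`u^*_{t_{[s,r]}} m_lam y` is a combination of the `u^*_z` for the paths `z` that dominate `t` from
level `s` on, strictly at level `s`. -/
theorem uStar_mul_m_mul_mem {r s : ℕ} (hsr : s ≤ r) {ν : T.Shape r} (t : T.SkewPath 0 r)
    (ht : t.vertex ⟨r, Nat.zero_le r, le_rfl⟩ = ν) (y : T.alg s)
    (hy : T.m s (t.vertex ⟨s, Nat.zero_le s, hsr⟩) * y ∈
      (T.datum s).above (t.vertex ⟨s, Nat.zero_le s, hsr⟩))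
    (P : Finset (T.Std r ν))
    (hP : ∀ z : T.Std r ν, (∀ (j : ℕ) (hj : j ≤ r),
      z.1.vertex ⟨j, Nat.zero_le j, hj⟩ ∈ T.dominatingShapes s t j) → z ∈ P) :
    ∃ c : T.Std r ν → R,
      T.uStar hsr (t.trunc s r (Nat.zero_le s) le_rfl) *
          (T.m s (t.vertex ⟨s, Nat.zero_le s, hsr⟩) * y) -
        ∑ z ∈ P, c z • T.uStar (Nat.zero_le r) z.1 ∈ T.above r ν := by
  have hU := T.isUpperSet_dominatingShapes s t
  choose q e hq he' he using fun j => (T.datum j).exists_scaled_right_identity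
    (T.splitSemisimple j) (hU j)
  obtain ⟨a, ha⟩ := T.exists_uStar_mul_m hsr (t.trunc s r (Nat.zero_le s) le_rfl) ht
  have hX : T.uStar hsr (t.trunc s r (Nat.zero_le s) le_rfl) *
      (T.m s (t.vertex ⟨s, Nat.zero_le s, hsr⟩) * y) =
      (T.m r ν * (a * Subalgebra.inclusion (T.alg_mono hsr) y : T.alg r) : B) := by
    rw [← mul_assoc]
    refine (congrArg (· * (y : B)) ha).trans ?_
    simp [mul_assoc]
  have hw : (T.datum r).act ν (a * Subalgebra.inclusion (T.alg_mono hsr) y) (T.δ r ν) ∈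
      Submodule.span R (T.pathVectors (T.dominatingShapes s t) r ν) := by
    refine mem_span_pathVectors hU he hq he' fun j hj => T.act_δ_eq_smul ?_
    rw [← hX, Subalgebra.coe_inclusion]
    rcases lt_trichotomy j s with h | rfl | h
    -- Below level s every shape is allowed, so the ideal contains 1 and e_j = q_j.
    · have h1 : (1 : T.alg j) ∈ (T.datum j).shapeSpan (T.dominatingShapes s t j) := by
        have : T.dominatingShapes s t j = Set.univ :=
          Set.eq_univ_of_forall fun μ hμ => absurd hμ.1 (not_le.2 h)
        rw [this, CellDatum.shapeSpan_univ]
        trivial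
      have h2 := congrArg (Subtype.val : T.alg j → B) (he j 1 h1)
      rw [one_mul] at h2
      rw [h2, SetLike.val_smul, OneMemClass.coe_one, mul_smul_comm, mul_one]
    -- At level s the strict condition is met by m_λ y itself, which lies in A_s^{▷λ}.
    · have h1 := he j _ ((T.datum j).shapeSpan_mono
        (V := T.dominatingShapes j t j) (fun μ hμ _ => ⟨le_of_lt hμ, fun _ => hμ⟩) hy)
      rw [mul_assoc, ← mul_smul_comm]
      exact congrArg _ (congrArg (Subtype.val : T.alg j → B) h1)
    -- Above level s only t(j) ∈ U_j is needed, as dominance there may be an equality.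
    · exact T.uStar_mul_eq_smul h.le hj (t.trunc s r (Nat.zero_le s) le_rfl) y (hU j)
        (fun _ => ⟨le_rfl, fun hs => absurd hs h.ne'⟩) (he j)
  obtain ⟨c, b, hb, hc⟩ := T.exists_sum_of_mem_span_pathVectors P hP hw
  refine ⟨c, ?_⟩
  rw [hX, ← hc]
  refine ⟨T.m r ν * (a * Subalgebra.inclusion (T.alg_mono hsr) y - b), ?_, ?_⟩
  · refine (T.m_mul_mem_above_iff _).2 ?_
    change (T.datum r).orbitMap ν (T.δ r ν) _ = 0
    rw [map_sub]
    exact sub_eq_zero.2 hb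
  · simp [mul_sub]

end DiagramAlgebras

open Classical in
theorem mainTheorem7 {R : Type u} {B : Type v} [CommRing R] [IsDomain R] [Ring B] [Algebra R B]
    (T : DiagramAlgebras.{u, v, w, w'} R B) (r s : ℕ) (hs : 1 ≤ s) (hsr : s < r)
    (ν : T.Shape r) (t : T.Std r ν) (a : B) (ha : a ∈ T.alg s)
    (lam : T.Shape s) (hlam : lam = t.1.vertex ⟨s, Nat.zero_le s, hsr.le⟩)
    (c : T.Std s lam → R)
    (hc : T.uStar (Nat.zero_le s) (t.1.trunc 0 s le_rfl hsr.le) * a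
        - ∑ p : T.Std s lam, c p • T.uStar (Nat.zero_le s) p.1 ∈ T.above s lam) :
    ∃ c' : T.Std r ν → R,
      T.uStar (Nat.zero_le r) t.1 * a
        - (∑ p : T.Std s lam, c p •
              (T.uStar hsr.le (t.1.trunc s r (Nat.zero_le s) le_rfl)
                * T.uStar (Nat.zero_le s) p.1)
            + ∑ z : T.Std r ν with
                (z.1.trunc s r (Nat.zero_le s) le_rfl).StrictlyDominates
                    (t.1.trunc s r (Nat.zero_le s) le_rfl) ∧
                  lam < z.1.vertex ⟨s, Nat.zero_le s, hsr.le⟩,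
              c' z • T.uStar (Nat.zero_le r) z.1) ∈ T.above r ν := by
  subst hlam
  obtain ⟨b, hb⟩ := T.exists_uStar_eq (t.1.trunc 0 s le_rfl hsr.le) rfl
  choose D hD using fun p : T.Std s (t.1.vertex ⟨s, Nat.zero_le s, hsr.le⟩) =>
    T.exists_uStar_eq p.1 p.2
  -- The error of the hypothesis as m_λ y.
  have hx : T.uStar (Nat.zero_le s) (t.1.trunc 0 s le_rfl hsr.le) * a
      - ∑ p, c p • T.uStar (Nat.zero_le s) p.1 =
      (T.m s (t.1.vertex ⟨s, Nat.zero_le s, hsr.le⟩) : B) *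
        ((b * ⟨a, ha⟩ - ∑ p, c p • D p : T.alg s) : B) := by
    rw [hb]
    simp only [hD]
    simp [mul_sub, Finset.mul_sum, mul_assoc]
    rfl
  have hy : T.m s (t.1.vertex ⟨s, Nat.zero_le s, hsr.le⟩) * (b * ⟨a, ha⟩ - ∑ p, c p • D p) ∈
      (T.datum s).above (t.1.vertex ⟨s, Nat.zero_le s, hsr.le⟩) := by
    rw [hx] at hc
    obtain ⟨x, hx1, hx2⟩ := hc
    have h : x = T.m s (t.1.vertex ⟨s, Nat.zero_le s, hsr.le⟩) *
      (b * ⟨a, ha⟩ - ∑ p, c p • D p) := Subtype.ext hx2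
    exact h ▸ hx1
  obtain ⟨c', hc'⟩ := T.uStar_mul_m_mul_mem hsr.le t.1 t.2 _ hy
    (Finset.univ.filter fun z : T.Std r ν =>
      (z.1.trunc s r (Nat.zero_le s) le_rfl).StrictlyDominates
        (t.1.trunc s r (Nat.zero_le s) le_rfl) ∧
      t.1.vertex ⟨s, Nat.zero_le s, hsr.le⟩ < z.1.vertex ⟨s, Nat.zero_le s, hsr.le⟩)
    (by
      intro z hz
      -- Strictness at level s also makes the truncated paths distinct.
      have hlt := (hz s hsr.le ⟨le_rfl, hsr.le⟩).2 rfl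
      refine Finset.mem_filter.2 ⟨Finset.mem_univ _, ⟨fun h => hlt.ne ?_, fun j => ?_⟩, hlt⟩
      · exact (congrArg (fun p => p.vertex ⟨s, le_rfl, hsr.le⟩) h).symm
      · exact (hz j j.2.2 ⟨j.2.1, j.2.2⟩).1)
  refine ⟨c', ?_⟩
  convert hc' using 1
  rw [← hx, T.uStar_split (Nat.zero_le s) hsr.le, mul_sub, Finset.mul_sum, ← sub_sub]
  simp only [mul_smul_comm, mul_assoc]
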